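/- Let $L^2=L^2(S^1,d\theta/2\pi)$ be the complex Hilbert space on the circle $S^1=\mathbb R/2\pi\mathbb Z$, and let $D=\partial_\theta$. For a real weight $w\in W^{1,\infty}(S^1)$ with $0<w_-\le w\le w_+<\infty$ a.e. and for $\lambda\ge 0$ put $$\langle f,g\rangle_{w,\lambda}=\int f\,\overline g\,w\,\frac{d\theta}{2\pi}+\lambda\int f'\,\overline{g'}\,\frac{d\theta}{2\pi}.$$ Let $H_{w,\lambda}\subset L^2$ be the Hilbert completion of the trigonometric polynomials for this inner product (so $H_{w,0}=L^2$ with the weighted inner product, and $H_{w,\lambda}=H^1(S^1)$ for $\lambda>0$), let $D^*_{w,\lambda}$ be the adjoint in $H_{w,\lambda}$ of the closed operator $D$ in $H_{w,\lambda}$, and let $\Delta_{w,\lambda}=D^*_{w,\lambda}D$ be the associated Laplacian. On trigonometric polynomials $\Delta_{w,\lambda}=A_{w,\lambda}^{-1}(-\partial_\theta)A_{w,\lambda}\,\partial_\theta$ with $A_{w,\lambda}f=wf-\lambda f''$. For every $\lambda\ge 0$ the operator $\Delta_{w,\lambda}$, regarded as an unbounded operator in $L^2$, is closable, and $1+\Delta_{w,\lambda}$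 (with $\Delta_{w,\lambda}$ now denoting the closure in $L^2$) has a bounded, everywhere defined inverse on $L^2$. There is a function $C=C(w_-,w_+,\|w'\|_{L^\infty})$, depending on these three numbers only, such that for all such $w$ and every $\lambda>0$ $$\big\|(1+\Delta_{w,\lambda})^{-1}-(1+\Delta_{w,0})^{-1}\big\|_{\mathcal B(L^2)}\le C(w_-,w_+,\|w'\|_{L^\infty})\,\lambda .$$ -/

import Mathlib

open MeasureTheory ComplexConjugate
open scoped ENNReal

namespace CircleGeometry

instance fact_two_pi_pos : Fact (0 < 2 * Real.pi) := ⟨Real.two_pi_pos⟩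

/-- The circle `S¹ = ℝ / 2πℤ`. -/
abbrev S1 : Type := AddCircle (2 * Real.pi)

/-- The normalised measure `dθ / 2π` on the circle. -/
noncomputable abbrev μ : Measure S1 := AddCircle.haarAddCircle

/-- The fixed complex Hilbert space `L²(S¹, dθ/2π)`. -/
abbrev L2 : Type := Lp ℂ 2 μ

/-- `g` is the weak derivative `∂_θ f`: for every character `e_n(θ) = e^{inθ}` one has
`∫ g e_{-n} = - ∫ f (e_{-n})'`, that is, `ĝ(n) = i n f̂(n)`. -/
def IsWeakDeriv (f g : S1 → ℂ) : Prop :=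
  ∀ n : ℤ, fourierCoeff g n = Complex.I * (n : ℂ) * fourierCoeff f n

/-- `w ∈ W^{1,∞}(S¹)` (real-valued), with weak derivative `w'`. -/
structure IsW1Infty (w w' : S1 → ℝ) : Prop where
  memLp : MemLp w ∞ μ
  memLp_deriv : MemLp w' ∞ μ
  isWeakDeriv : IsWeakDeriv (fun θ => (w θ : ℂ)) (fun θ => (w' θ : ℂ))

/-- The Sobolev space `H¹(S¹) = {f ∈ L² : ∂_θ f ∈ L²}`. -/
def H1 : Set L2 := {f | ∃ g : L2, IsWeakDeriv f g}

open Classical in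
/-- `D f = ∂_θ f` for `f ∈ H¹(S¹)` (and `0` for other `f`; this value is never relevant). -/
noncomputable def D (f : L2) : L2 :=
  if h : ∃ g : L2, IsWeakDeriv f g then h.choose else 0

theorem isWeakDeriv_unique {f g h : L2} (hg : IsWeakDeriv f g) (hh : IsWeakDeriv f h) :
    g = h := by
  apply (fourierBasis (T := 2 * Real.pi)).repr.injective
  ext n
  rw [fourierBasis_repr, fourierBasis_repr, hg n, hh n]

theorem isWeakDeriv_D {f : L2} (hf : f ∈ H1) : IsWeakDeriv f (D f) := by
  have h : ∃ g : L2, IsWeakDeriv f g := hf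
  rw [D, dif_pos h]
  exact h.choose_spec

theorem D_eq {f g : L2} (h : IsWeakDeriv f g) : D f = g :=
  isWeakDeriv_unique (isWeakDeriv_D ⟨g, h⟩) h

/-- The inner product
`⟨f, g⟩_{w,lam} = ∫ f ḡ w dθ/2π + lam ∫ f' ḡ' dθ/2π`.
For `lam = 0` it is the weighted inner product `⟨f, g⟩_w`. -/
noncomputable def geomInner (w : S1 → ℝ) (lam : ℝ) (f g : L2) : ℂ :=
  (∫ θ, f θ * conj (g θ) * (w θ : ℂ) ∂μ) + (lam : ℂ) * ∫ θ, D f θ * conj (D g θ) ∂μ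

open Classical in
/-- The Hilbert completion of the trigonometric polynomials for `⟨·,·⟩_{w,lam}`, realised inside
`L²`, for a weight bounded above and away from `0`: all of `L²` if `lam = 0`,
and `H¹` if `lam > 0`. -/
noncomputable def geomSpace (lam : ℝ) : Set L2 :=
  if lam = 0 then Set.univ else H1

/-- The domain of (the closure of) the derivation `D = ∂_θ` in the Hilbert space
`geomSpace lam`: those `u` with `u ∈ geomSpace lam` and `u' ∈ geomSpace lam`. -/
def derivationDomain (lam : ℝ) : Set L2 :=
  {u | u ∈ geomSpace lam ∧ u ∈ H1 ∧ D u ∈ geomSpace lam}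

/-- The graph of the Hilbert adjoint `D*` of the derivation, with respect to `⟨·,·⟩_{w,lam}`. -/
def adjointGraph (w : S1 → ℝ) (lam : ℝ) : Set (L2 × L2) :=
  {p | p.1 ∈ geomSpace lam ∧ p.2 ∈ geomSpace lam ∧
    ∀ v ∈ derivationDomain lam, geomInner w lam (D v) p.1 = geomInner w lam v p.2}

/-- The graph of the Laplacian `Δ_{w,lam} = D* D`, the adjoint being that
of the geometry `⟨·,·⟩_{w,lam}`. -/
def laplacianGraph (w : S1 → ℝ) (lam : ℝ) : Set (L2 × L2) :=
  {p | p.1 ∈ derivationDomain lam ∧ (D p.1, p.2) ∈ adjointGraph w lam}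

/-- `R = (1 + T)⁻¹` as a bounded operator on `L²`, where `T` is an unbounded linear operator in
`L²`, given by its graph: `T` is closable in `L²`, and `R` is the everywhere defined inverse
of `1 + T`, with `T` standing for its closure, i.e. `R f = u` if and only if
`u ∈ Dom T` and `u + T u = f`. -/
structure IsResolvent (T : Set (L2 × L2)) (R : L2 →L[ℂ] L2) : Prop where
  closable : ∀ h : L2, ((0 : L2), h) ∈ closure T → h = 0
  apply_eq_iff : ∀ f u : L2, R f = u ↔ (u, f - u) ∈ closure T

end CircleGeometry

/-! Write `W` for multiplication by `w`. Pairing `u + Δu = f` with a test function and integrating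
by parts turns the resolvent equation into an elliptic problem in weak form: `Wu - ∂W∂u = Wf` for
`lam = 0`, and `Wu - ∂(W + lam)∂u + lam ∂⁴u = Wf - lam ∂²f` for `lam > 0`. Both forms are symmetric
and coercive on `H¹` resp. `H²`, and the right-hand sides make sense for every `f ∈ L²`. Lax–Milgram
therefore gives bounded solution operators on `L²`, and these are injective. They invert `1 + Δ` on
its original graph, and density of `H¹` identifies them with the resolvents of the closures
(`isResolvent_of_dense`).

The rate comes from duality. Let `u`, `u₀` be the two solutions and let `φ` solve the fourth-order
problem with right-hand side `u - u₀`. Since `u₀ ∈ H²` (division by `w` preserves `H¹`), testing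
gives, up to conjugation, `‖u - u₀‖² = -lam ⟪φ'', f - u₀ + u₀''⟫`. The second-order equation says `w
(f - u₀ + u₀'') = -w' u₀'`, which is bounded by `‖f‖`. The remaining point is a bound for `‖φ''‖` by
`‖u - u₀‖` that is uniform in `lam` (`IsWeakSol₄.exists_norm_deriv_le`). No derivative of `w'` ever
appears. -/

namespace CircleGeometry

open scoped InnerProductSpace

/-! ### Fourier coefficients and weak derivatives -/

/-- The Fourier coefficients of an element of `L²(S¹)`, as an `ℓ²` sequence. -/
noncomputable abbrev coeff : L2 ≃ₗᵢ[ℂ] lp (fun _ : ℤ => ℂ) 2 :=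
  (fourierBasis (T := 2 * Real.pi)).repr

/-- The character `θ ↦ e^{inθ}` in `L²(S¹)`. -/
noncomputable abbrev character (n : ℤ) : L2 := fourierLp (T := 2 * Real.pi) 2 n

theorem coeff_ext {f g : L2} (h : ∀ n, coeff f n = coeff g n) : f = g :=
  coeff.injective (lp.ext (funext h))

theorem coeff_eq_inner (f : L2) (n : ℤ) : coeff f n = ⟪character n, f⟫_ℂ := by
  rw [HilbertBasis.repr_apply_apply, coe_fourierBasis]

theorem isWeakDeriv_iff {f g : L2} :
    IsWeakDeriv f g ↔ ∀ n : ℤ, coeff g n = Complex.I * n * coeff f n := by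
  simp only [fourierBasis_repr]; rfl

theorem isWeakDeriv_character (n : ℤ) :
    IsWeakDeriv (character n) ((Complex.I * n) • character n : L2) := by
  rw [isWeakDeriv_iff]
  intro m
  have h : coeff (character n) m = if m = n then 1 else 0 := by
    rw [coeff_eq_inner]
    exact (orthonormal_iff_ite.1 (orthonormal_fourier (T := 2 * Real.pi))) m n
  rw [map_smul, lp.coeFn_smul, Pi.smul_apply, h, smul_eq_mul]
  by_cases hmn : m = n <;> simp [hmn]

theorem IsWeakDeriv.add {f g f₁ g₁ : L2} (h : IsWeakDeriv f g) (h₁ : IsWeakDeriv f₁ g₁) :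
    IsWeakDeriv (f + f₁ : L2) (g + g₁ : L2) := by
  rw [isWeakDeriv_iff] at *
  intro n
  simp only [map_add, lp.coeFn_add, Pi.add_apply, h n, h₁ n]
  ring

theorem IsWeakDeriv.sub {f g f₁ g₁ : L2} (h : IsWeakDeriv f g) (h₁ : IsWeakDeriv f₁ g₁) :
    IsWeakDeriv (f - f₁ : L2) (g - g₁ : L2) := by
  rw [isWeakDeriv_iff] at *
  intro n
  simp only [map_sub, lp.coeFn_sub, Pi.sub_apply, h n, h₁ n]
  ring

theorem IsWeakDeriv.smul {f g : L2} (c : ℂ) (h : IsWeakDeriv f g) :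
    IsWeakDeriv (c • f : L2) (c • g : L2) := by
  rw [isWeakDeriv_iff] at *
  intro n
  simp only [map_smul, lp.coeFn_smul, Pi.smul_apply, h n, smul_eq_mul]
  ring

/-- Integration by parts. -/
theorem IsWeakDeriv.inner_eq_neg {f f' g g' : L2} (hf : IsWeakDeriv f f') (hg : IsWeakDeriv g g') :
    ⟪f', g⟫_ℂ = -⟪f, g'⟫_ℂ := by
  rw [isWeakDeriv_iff] at hf hg
  rw [← coeff.inner_map_map f' g, ← coeff.inner_map_map f g', lp.inner_eq_tsum, lp.inner_eq_tsum,
    ← tsum_neg]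
  refine tsum_congr fun n => ?_
  rw [hf n, hg n]
  simp only [RCLike.inner_apply, map_mul, Complex.conj_I, map_intCast]
  ring

/-- An element of `L²` whose distributional derivative is in `L²`. -/
theorem isWeakDeriv_of_inner {a h : L2}
    (H : ∀ v v' : L2, IsWeakDeriv v v' → ⟪v', a⟫_ℂ = -⟪v, h⟫_ℂ) : IsWeakDeriv a h := by
  rw [isWeakDeriv_iff]
  intro n
  have := H _ _ (isWeakDeriv_character n)
  rw [inner_smul_left] at this
  rw [coeff_eq_inner, coeff_eq_inner, ← neg_neg ⟪character n, h⟫_ℂ, ← this]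
  simp

/-! ### The inverse of `K + ∂_θ` -/

theorem add_I_mul_ne_zero {K : ℝ} (hK : K ≠ 0) (n : ℤ) : (K : ℂ) + Complex.I * n ≠ 0 := by
  intro h
  apply hK
  simpa using congrArg Complex.re h

theorem norm_inv_add_I_mul_le {K : ℝ} (hK : K ≠ 0) (n : ℤ) :
    ‖((K : ℂ) + Complex.I * n)⁻¹‖ ≤ |K|⁻¹ := by
  rw [norm_inv]
  refine inv_anti₀ (abs_pos.2 hK) ?_
  simpa using Complex.abs_re_le_norm ((K : ℂ) + Complex.I * n)

/-- The Fourier multiplier `1 / (K + i n)`, that is, `(K + ∂_θ)⁻¹`. -/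
noncomputable def derivResolvent (K : ℝ) (hK : K ≠ 0) : L2 →L[ℂ] L2 :=
  (coeff.symm.toContinuousLinearEquiv : lp (fun _ : ℤ => ℂ) 2 →L[ℂ] L2) ∘L
    lp.mapCLM 2 (fun n : ℤ => ((K : ℂ) + Complex.I * n)⁻¹ • ContinuousLinearMap.id ℂ ℂ)
      (inv_nonneg.2 (abs_nonneg K))
      (fun n => by
        rw [norm_smul, ContinuousLinearMap.norm_id, mul_one]
        exact norm_inv_add_I_mul_le hK n) ∘L
    (coeff.toContinuousLinearEquiv : L2 →L[ℂ] lp (fun _ : ℤ => ℂ) 2)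

theorem coeff_derivResolvent {K : ℝ} (hK : K ≠ 0) (f : L2) (n : ℤ) :
    coeff (derivResolvent K hK f) n = ((K : ℂ) + Complex.I * n)⁻¹ * coeff f n := by
  simp [derivResolvent]

theorem norm_derivResolvent_le {K : ℝ} (hK : K ≠ 0) (f : L2) :
    ‖derivResolvent K hK f‖ ≤ |K|⁻¹ * ‖f‖ := by
  simp only [derivResolvent, ContinuousLinearMap.comp_apply]
  refine (coeff.symm.norm_map _).le.trans ?_
  refine (ContinuousLinearMap.le_of_opNorm_le _ (lp.norm_mapCLM_le _ _ _ _) _).trans ?_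
  exact le_of_eq (congrArg _ (coeff.norm_map f))

theorem isWeakDeriv_derivResolvent {K : ℝ} (hK : K ≠ 0) (f : L2) :
    IsWeakDeriv (derivResolvent K hK f) (f - (K : ℂ) • derivResolvent K hK f : L2) := by
  rw [isWeakDeriv_iff]
  intro n
  have := add_I_mul_ne_zero hK n
  simp only [map_sub, map_smul, lp.coeFn_sub, lp.coeFn_smul, Pi.sub_apply, Pi.smul_apply,
    smul_eq_mul, coeff_derivResolvent]
  field_simp
  ring

theorem IsWeakDeriv.derivResolvent_eq {f g : L2} {K : ℝ} (hK : K ≠ 0) (h : IsWeakDeriv f g) :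
    derivResolvent K hK ((K : ℂ) • f + g) = f := by
  rw [isWeakDeriv_iff] at h
  refine coeff_ext fun n => ?_
  have := add_I_mul_ne_zero hK n
  simp only [map_add, map_smul, lp.coeFn_add, lp.coeFn_smul, Pi.add_apply, Pi.smul_apply,
    smul_eq_mul, coeff_derivResolvent, h n]
  field_simp

/-- An element of `L²` whose second distributional derivative is in `L²` is in `H²`. -/
theorem exists_isWeakDeriv_of_inner {a h : L2}
    (H : ∀ v v' v'' : L2, IsWeakDeriv v v' → IsWeakDeriv v' v'' → ⟪v'', a⟫_ℂ = ⟪v, h⟫_ℂ) :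
    ∃ b : L2, IsWeakDeriv a b ∧ IsWeakDeriv b h := by
  have hc : ∀ n : ℤ, coeff h n = (Complex.I * n) * (Complex.I * n) * coeff a n := by
    intro n
    have := H _ _ _ (isWeakDeriv_character n) ((isWeakDeriv_character n).smul (Complex.I * n))
    rw [smul_smul, inner_smul_left] at this
    rw [coeff_eq_inner, coeff_eq_inner, ← this]
    simp
  have h1 : (1 : ℝ) ≠ 0 := one_ne_zero
  have hm1 : (-1 : ℝ) ≠ 0 := neg_ne_zero.2 one_ne_zero
  -- Factor `∂² - 1 = (∂ + 1)(∂ - 1)`: the hypothesis says `(∂² - 1) a = h - a`, so `y` equals `(∂ +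
  -- 1) a` and `y - a` is the first derivative of `a`.
  set y := derivResolvent (-1) hm1 (h - a) with hy
  have hya : derivResolvent 1 h1 y = a := by
    refine coeff_ext fun n => ?_
    have e1 := add_I_mul_ne_zero h1 n
    have e2 := add_I_mul_ne_zero hm1 n
    rw [coeff_derivResolvent, hy, coeff_derivResolvent, map_sub, lp.coeFn_sub, Pi.sub_apply, hc n]
    field_simp
    push_cast
    ring
  have d1 := isWeakDeriv_derivResolvent h1 y
  have d2 := isWeakDeriv_derivResolvent hm1 (h - a)
  rw [hya] at d1
  rw [← hy] at d2
  refine ⟨_, d1, ?_⟩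
  have e : h - a - ((-1 : ℝ) : ℂ) • y - ((1 : ℝ) : ℂ) • (y - ((1 : ℝ) : ℂ) • a) = h := by
    push_cast
    module
  have := d2.sub (d1.smul ((1 : ℝ) : ℂ))
  rwa [e] at this

theorem dense_H1 : Dense H1 := by
  have hd : Dense ((Submodule.span ℂ (Set.range (fourierBasis (T := 2 * Real.pi))) :
      Submodule ℂ L2) : Set L2) := by
    rw [Submodule.dense_iff_topologicalClosure_eq_top, (fourierBasis (T := 2 * Real.pi)).dense_span]
  refine hd.mono fun x hx => ?_
  induction hx using Submodule.span_induction with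
  | mem x hx =>
    obtain ⟨n, rfl⟩ := hx
    rw [coe_fourierBasis]
    exact ⟨_, isWeakDeriv_character n⟩
  | zero => exact ⟨0, by simpa using (isWeakDeriv_character 0).smul 0⟩
  | add x y _ _ hx hy =>
    obtain ⟨x', hx⟩ := hx
    obtain ⟨y', hy⟩ := hy
    exact ⟨_, hx.add hy⟩
  | smul c x _ hx =>
    obtain ⟨x', hx⟩ := hx
    exact ⟨_, hx.smul c⟩

/-! ### Multiplication operators -/

theorem memLp_ofReal_mul {w : S1 → ℝ} (hw : MemLp w ∞ μ) (f : L2) :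
    MemLp (fun θ => (w θ : ℂ) * f θ) 2 μ :=
  (Lp.memLp f).mul' (p := ∞) hw.ofReal

/-- Multiplication by a bounded real function, as an operator in `L²`. -/
noncomputable def mulOp (w : S1 → ℝ) (hw : MemLp w ∞ μ) : L2 →L[ℂ] L2 :=
  LinearMap.mkContinuous
    { toFun := fun f => (memLp_ofReal_mul hw f).toLp
      map_add' := fun f g => by
        rw [← MemLp.toLp_add, MemLp.toLp_eq_toLp_iff]
        filter_upwards [Lp.coeFn_add f g] with θ h
        simp only [h, Pi.add_apply, mul_add]
      map_smul' := fun c f => by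
        rw [RingHom.id_apply, ← MemLp.toLp_const_smul, MemLp.toLp_eq_toLp_iff]
        filter_upwards [Lp.coeFn_smul c f] with θ h
        simp only [h, Pi.smul_apply, smul_eq_mul]
        ring }
    (eLpNorm w ∞ μ).toReal
    (fun f => by
      refine Lp.norm_le_mul_norm_of_ae_le_mul ?_
      filter_upwards [MemLp.coeFn_toLp (memLp_ofReal_mul hw f), ae_le_eLpNormEssSup (f := w) (μ := μ)]
        with θ h1 h2
      simp only [LinearMap.coe_mk, AddHom.coe_mk]
      rw [h1, norm_mul, Complex.norm_real]
      gcongr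
      rw [eLpNorm_exponent_top, ← toReal_enorm]
      exact ENNReal.toReal_mono (by simpa using hw.2.ne) h2)

theorem coeFn_mulOp {w : S1 → ℝ} (hw : MemLp w ∞ μ) (f : L2) :
    mulOp w hw f =ᵐ[μ] fun θ => (w θ : ℂ) * f θ :=
  MemLp.coeFn_toLp (memLp_ofReal_mul hw f)

theorem norm_mulOp_le {w : S1 → ℝ} (hw : MemLp w ∞ μ) (f : L2) :
    ‖mulOp w hw f‖ ≤ (eLpNorm w ∞ μ).toReal * ‖f‖ :=
  ContinuousLinearMap.le_of_opNorm_le _ (LinearMap.mkContinuous_norm_le _ ENNReal.toReal_nonneg _) f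

theorem norm_mulOp_le_of_ae {w : S1 → ℝ} (hw : MemLp w ∞ μ) {c : ℝ} (h : ∀ᵐ θ ∂μ, |w θ| ≤ c)
    (f : L2) : ‖mulOp w hw f‖ ≤ c * ‖f‖ := by
  refine Lp.norm_le_mul_norm_of_ae_le_mul ?_
  filter_upwards [coeFn_mulOp hw f, h] with θ h1 h2
  rw [h1, norm_mul, Complex.norm_real, Real.norm_eq_abs]
  gcongr

theorem inner_mulOp {w : S1 → ℝ} (hw : MemLp w ∞ μ) (f g : L2) :
    ⟪g, mulOp w hw f⟫_ℂ = ∫ θ, f θ * conj (g θ) * (w θ : ℂ) ∂μ := by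
  rw [L2.inner_def]
  refine integral_congr_ae ?_
  filter_upwards [coeFn_mulOp hw f] with θ h
  rw [h, RCLike.inner_apply]
  ring

theorem inner_mulOp_left {w : S1 → ℝ} (hw : MemLp w ∞ μ) (f g : L2) :
    ⟪mulOp w hw g, f⟫_ℂ = ⟪g, mulOp w hw f⟫_ℂ := by
  rw [L2.inner_def, L2.inner_def]
  refine integral_congr_ae ?_
  filter_upwards [coeFn_mulOp hw f, coeFn_mulOp hw g] with θ h h'
  rw [h, h']
  simp only [RCLike.inner_apply, map_mul, Complex.conj_ofReal]
  ring

theorem le_re_inner_mulOp {w : S1 → ℝ} (hw : MemLp w ∞ μ) {c : ℝ} (h : ∀ᵐ θ ∂μ, c ≤ w θ)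
    (f : L2) : c * ‖f‖ ^ 2 ≤ (⟪mulOp w hw f, f⟫_ℂ).re := by
  have hi := L2.integrable_inner (𝕜 := ℂ) (mulOp w hw f) f
  have hi' := L2.integrable_inner (𝕜 := ℂ) f f
  have e : ‖f‖ ^ 2 = (⟪f, f⟫_ℂ).re := (inner_self_eq_norm_sq (𝕜 := ℂ) f).symm
  rw [e, L2.inner_def, L2.inner_def]
  simp only [← RCLike.re_to_complex]
  rw [← integral_re hi, ← integral_re hi', ← integral_const_mul]
  refine integral_mono_ae (hi'.re.const_mul c) hi.re ?_
  filter_upwards [coeFn_mulOp hw f, h] with θ h1 h2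
  have e1 : ⟪f θ, f θ⟫_ℂ = ((‖f θ‖ ^ 2 : ℝ) : ℂ) := by
    rw [inner_self_eq_norm_sq_to_K]; norm_cast
  have e2 : ⟪mulOp w hw f θ, f θ⟫_ℂ = ((w θ * ‖f θ‖ ^ 2 : ℝ) : ℂ) := by
    rw [h1, ← smul_eq_mul, inner_smul_left, e1]
    simp
  simp only [e1, e2, RCLike.re_to_complex, Complex.ofReal_re]
  gcongr

theorem coeff_mulOp_character {w : S1 → ℝ} (hw : MemLp w ∞ μ) (m n : ℤ) :
    coeff (mulOp w hw (character m)) n = fourierCoeff (fun θ => (w θ : ℂ)) (n - m) := by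
  rw [fourierBasis_repr]
  refine integral_congr_ae ?_
  filter_upwards [coeFn_mulOp hw (character m), coeFn_fourierLp (T := 2 * Real.pi) 2 m] with θ h h'
  rw [h, h', neg_sub, sub_eq_add_neg, add_comm, fourier_add, smul_eq_mul, smul_eq_mul]
  ring

/-- Leibniz rule for the product of a `W^{1,∞}` function and an `H¹` function. -/
theorem IsWeakDeriv.mulOp {w w' : S1 → ℝ} (hw : IsW1Infty w w') {f f' : L2}
    (hf : IsWeakDeriv f f') :
    IsWeakDeriv (mulOp w hw.memLp f)
      (CircleGeometry.mulOp w' hw.memLp_deriv f + CircleGeometry.mulOp w hw.memLp f' : L2) := by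
  have h1 : (1 : ℝ) ≠ 0 := one_ne_zero
  set W := CircleGeometry.mulOp w hw.memLp
  set W' := CircleGeometry.mulOp w' hw.memLp_deriv
  set S := derivResolvent 1 h1
  -- Every `f ∈ H¹` is `S x` with `x = f + f'`, and then `f' = x - S x`. Both sides are continuous
  -- in `x`, so characters suffice; there the rule reads `i(n-m) + im = in`, multiplied by the
  -- coefficient of `w` at `n - m`.
  have key : ∀ n : ℤ,
      innerSL ℂ (character n) ∘L (W' ∘L S + W ∘L (ContinuousLinearMap.id ℂ L2 - S)) =
      (Complex.I * n) • (innerSL ℂ (character n) ∘L W ∘L S) := by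
    intro n
    refine ContinuousLinearMap.ext_on (s := Set.range (fourierBasis (T := 2 * Real.pi))) ?_ ?_
    · rw [Submodule.dense_iff_topologicalClosure_eq_top,
        (fourierBasis (T := 2 * Real.pi)).dense_span]
    · rintro _ ⟨m, rfl⟩
      rw [coe_fourierBasis]
      have hne := add_I_mul_ne_zero h1 m
      have e : S (character m) = (((1 : ℝ) : ℂ) + Complex.I * m)⁻¹ • character m := by
        rw [← inv_smul_smul₀ hne (S (character m)), ← map_smul, add_smul]
        exact congrArg _ ((isWeakDeriv_character m).derivResolvent_eq h1)
      simp only [ContinuousLinearMap.comp_apply, add_apply,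
        sub_apply, smul_apply, map_add, map_sub, e,
        map_smul, innerSL_apply_apply, ← coeff_eq_inner, ContinuousLinearMap.id_apply]
      have c1 := coeff_mulOp_character hw.memLp m n
      have c2 := coeff_mulOp_character hw.memLp_deriv m n
      rw [hw.isWeakDeriv] at c2
      rw [c1, c2]
      simp only [smul_eq_mul]
      push_cast at hne ⊢
      field_simp
      ring
  rw [isWeakDeriv_iff]
  intro n
  have k := congrArg (fun T => T (((1 : ℝ) : ℂ) • f + f')) (key n)
  have e := hf.derivResolvent_eq h1
  simp only [ContinuousLinearMap.comp_apply, add_apply,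
    sub_apply, smul_apply,
    innerSL_apply_apply, ← coeff_eq_inner, ContinuousLinearMap.id_apply] at k
  rw [show S (((1 : ℝ) : ℂ) • f + f') = f from e] at k
  simpa using k

/-- Lax–Milgram theorem for a bounded operator with coercive real part. -/
theorem isUnit_of_coercive {T : L2 →L[ℂ] L2} {c : ℝ} (hc : 0 < c)
    (h : ∀ x, c * ‖x‖ ^ 2 ≤ (⟪T x, x⟫_ℂ).re) : IsUnit T := by
  refine T.isUnit_of_forall_le_norm_inner_map (c := ⟨c, hc.le⟩) hc fun x => ?_
  rw [mul_comm]
  exact (h x).trans (Complex.re_le_norm _)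

theorem mulOp_injective {w : S1 → ℝ} (hw : MemLp w ∞ μ) {c : ℝ} (hc : 0 < c)
    (h : ∀ᵐ θ ∂μ, c ≤ w θ) : Function.Injective (mulOp w hw) :=
  ((ContinuousLinearMap.isUnit_iff_bijective).1
    (isUnit_of_coercive hc (le_re_inner_mulOp hw h))).1

/-- Division by a `W^{1,∞}` function bounded away from `0` preserves `H¹`. -/
theorem exists_isWeakDeriv_of_mulOp {w w' : S1 → ℝ} (hw : IsW1Infty w w') {c : ℝ} (hc : 0 < c)
    (h : ∀ᵐ θ ∂μ, c ≤ w θ) {v p : L2} (hv : IsWeakDeriv (mulOp w hw.memLp v) p) :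
    ∃ v' : L2, IsWeakDeriv v v' := by
  set M := (eLpNorm w' ∞ μ).toReal with hM
  have hM0 : 0 ≤ M := ENNReal.toReal_nonneg
  -- By the Leibniz rule `(K + ∂) W S = W + W' S`. With this `K` the perturbation `W' S` has norm at
  -- most `M / K < c`, and the coercivity constant that remains is `c - M / K = c / K`.
  have hK : 0 < M / c + 1 := by positivity
  set K := M / c + 1 with hKdef
  set W := mulOp w hw.memLp
  set W' := mulOp w' hw.memLp_deriv
  set S := derivResolvent K hK.ne'
  have hT : ∀ x, (c - M * K⁻¹) * ‖x‖ ^ 2 ≤ (⟪(W + W' ∘L S) x, x⟫_ℂ).re := by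
    intro x
    have h1 := le_re_inner_mulOp hw.memLp h x
    have h2 : ‖⟪W' (S x), x⟫_ℂ‖ ≤ M * (K⁻¹ * ‖x‖) * ‖x‖ := by
      refine (norm_inner_le_norm _ _).trans ?_
      gcongr
      refine (norm_mulOp_le hw.memLp_deriv _).trans ?_
      gcongr
      simpa [abs_of_pos hK] using norm_derivResolvent_le hK.ne' x
    have h3 := (abs_le.1 ((Complex.abs_re_le_norm _).trans h2)).1
    rw [add_apply, inner_add_left, Complex.add_re, ContinuousLinearMap.comp_apply]
    nlinarith
  have hpos : 0 < c - M * K⁻¹ := by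
    have : c - M * K⁻¹ = c / K := by
      rw [hKdef] at hK ⊢
      field_simp
      ring
    rw [this]
    positivity
  -- The right-hand side is `(K + ∂)(W v)`, so applying `S` yields `W (S x) = W v`. Hence `v = S x`
  -- lies in the range of `(K + ∂)⁻¹`, which is `H¹`.
  obtain ⟨x, hx⟩ := ((ContinuousLinearMap.isUnit_iff_bijective).1
    (isUnit_of_coercive hpos hT)).2 ((K : ℂ) • W v + p)
  have e1 : S ((W + W' ∘L S) x) = W v := by
    rw [hx]
    exact hv.derivResolvent_eq hK.ne'
  have e2 : S ((W + W' ∘L S) x) = W (S x) := by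
    rw [← ((isWeakDeriv_derivResolvent hK.ne' x).mulOp hw).derivResolvent_eq hK.ne']
    congr 1
    rw [map_sub, map_smul, add_apply, ContinuousLinearMap.comp_apply]
    change W x + W' (S x) = (K : ℂ) • W (S x) + (W' (S x) + (W x - (K : ℂ) • W (S x)))
    abel
  have e3 : v = S x := mulOp_injective hw.memLp hc h (e1.symm.trans e2)
  exact ⟨_, e3 ▸ isWeakDeriv_derivResolvent hK.ne' x⟩

/-! ### Weak solutions -/

/-- `u ∈ H¹` solves `W u - ∂ W ∂ u = h` weakly. -/
def IsWeakSol₂ (W : L2 →L[ℂ] L2) (u h : L2) : Prop :=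
  ∃ u' : L2, IsWeakDeriv u u' ∧ ∀ v v' : L2, IsWeakDeriv v v' →
    ⟪v, W u⟫_ℂ + ⟪v', W u'⟫_ℂ = ⟪v, h⟫_ℂ

/-- `u ∈ H²` solves `W u - ∂ (W + lam) ∂ u + lam ∂⁴ u = h + ∂² k` weakly. -/
def IsWeakSol₄ (W : L2 →L[ℂ] L2) (lam : ℝ) (u h k : L2) : Prop :=
  ∃ u' u'' : L2, IsWeakDeriv u u' ∧ IsWeakDeriv u' u'' ∧
    ∀ v v' v'' : L2, IsWeakDeriv v v' → IsWeakDeriv v' v'' →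
      ⟪v, W u⟫_ℂ + ⟪v', W u'⟫_ℂ + lam * ⟪v', u'⟫_ℂ + lam * ⟪v'', u''⟫_ℂ =
        ⟪v, h⟫_ℂ + ⟪v'', k⟫_ℂ

theorem exists_rightInverse_of_coercive {T : L2 →L[ℂ] L2} {c : ℝ} (hc : 0 < c)
    (h : ∀ x, c * ‖x‖ ^ 2 ≤ (⟪T x, x⟫_ℂ).re) : ∃ Q : L2 →L[ℂ] L2, ∀ g, T (Q g) = g := by
  obtain ⟨U, rfl⟩ := isUnit_of_coercive hc h
  exact ⟨↑U⁻¹, fun g => congrArg (fun A : L2 →L[ℂ] L2 => A g) U.mul_inv⟩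

/-- `S = (1 + ∂)⁻¹` and `S' = ∂S = 1 - S` parametrise `H¹` by `L²`. Through them a form on `H¹`
becomes a bounded operator on `L²`. -/
theorem exists_resolvent_pair :
    ∃ S S' : L2 →L[ℂ] L2, (∀ x, IsWeakDeriv (S x) (S' x)) ∧ (∀ x, S x + S' x = x) ∧
      ∀ v v' : L2, IsWeakDeriv v v' → S (v + v') = v ∧ S' (v + v') = v' := by
  have h1 : (1 : ℝ) ≠ 0 := one_ne_zero
  refine ⟨derivResolvent 1 h1, ContinuousLinearMap.id ℂ L2 - derivResolvent 1 h1,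
    fun x => ?_, fun x => ?_, fun v v' hv => ?_⟩
  · have h := isWeakDeriv_derivResolvent h1 x
    rwa [Complex.ofReal_one, one_smul] at h
  · simp
  · have e : derivResolvent 1 h1 (v + v') = v := by simpa using hv.derivResolvent_eq h1
    refine ⟨e, ?_⟩
    rw [sub_apply, ContinuousLinearMap.id_apply, e]
    abel

/-- Substituting `u = S x` turns the form into `S* W S + S'* W S'`, which is coercive because `x = S
x + S' x`. -/
theorem exists_solutionOp₂ {W : L2 →L[ℂ] L2} {c : ℝ} (hc : 0 < c)
    (hW : ∀ x, c * ‖x‖ ^ 2 ≤ (⟪W x, x⟫_ℂ).re) :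
    ∃ A : L2 →L[ℂ] L2, ∀ h, IsWeakSol₂ W (A h) h := by
  obtain ⟨S, S', hS, hadd, hSS'⟩ := exists_resolvent_pair
  have hT : ∀ x, c / 2 * ‖x‖ ^ 2 ≤
      (⟪(S.adjoint ∘L W ∘L S + S'.adjoint ∘L W ∘L S') x, x⟫_ℂ).re := by
    intro x
    simp only [add_apply, ContinuousLinearMap.comp_apply, inner_add_left,
      ContinuousLinearMap.adjoint_inner_left, Complex.add_re]
    have h2 : ‖x‖ ≤ ‖S x‖ + ‖S' x‖ := by
      refine le_trans (le_of_eq ?_) (norm_add_le _ _)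
      rw [hadd]
    have h3 : ‖x‖ ^ 2 ≤ 2 * (‖S x‖ ^ 2 + ‖S' x‖ ^ 2) := by
      nlinarith [norm_nonneg x, sq_nonneg (‖S x‖ - ‖S' x‖)]
    nlinarith [hW (S x), hW (S' x)]
  obtain ⟨Q, hQ⟩ := exists_rightInverse_of_coercive (half_pos hc) hT
  refine ⟨S ∘L Q ∘L S.adjoint, fun h => ⟨S' (Q (S.adjoint h)), hS _, fun v v' hv => ?_⟩⟩
  obtain ⟨e1, e2⟩ := hSS' _ _ hv
  have := congrArg (fun z => ⟪v + v', z⟫_ℂ) (hQ (S.adjoint h))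
  simpa only [add_apply, ContinuousLinearMap.comp_apply, inner_add_right,
      ContinuousLinearMap.adjoint_inner_right, e1, e2] using this

/-- The same substitution with `u = S² x`. The coercivity constant degenerates as `lam → 0`, which
is harmless: only existence and boundedness are taken from here. -/
theorem exists_solutionOp₄ {W : L2 →L[ℂ] L2} {c : ℝ} (hc : 0 < c)
    (hW : ∀ x, c * ‖x‖ ^ 2 ≤ (⟪W x, x⟫_ℂ).re) {lam : ℝ} (hlam : 0 < lam) :
    ∃ A B : L2 →L[ℂ] L2, ∀ h k, IsWeakSol₄ W lam (A h + B k) h k := by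
  obtain ⟨S, S', hS, hadd, hSS'⟩ := exists_resolvent_pair
  have hcomm : ∀ x, S (S' x) = S' (S x) := fun x => by
    have h1 := congrArg S (hadd x)
    rw [map_add] at h1
    exact add_left_cancel (h1.trans (hadd (S x)).symm)
  set J₀ := S ∘L S
  set J₁ := S ∘L S'
  set J₂ := S' ∘L S'
  set T := J₀.adjoint ∘L W ∘L J₀ + J₁.adjoint ∘L W ∘L J₁ +
    (lam : ℂ) • (J₁.adjoint ∘L J₁) + (lam : ℂ) • (J₂.adjoint ∘L J₂)
  have hm : 0 < min c lam / 6 := by positivity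
  have hT : ∀ x, min c lam / 6 * ‖x‖ ^ 2 ≤ (⟪T x, x⟫_ℂ).re := by
    intro x
    have e' : ∀ J : L2 →L[ℂ] L2, ⟪(J.adjoint ∘L W ∘L J) x, x⟫_ℂ = ⟪W (J x), J x⟫_ℂ := fun J =>
      J.adjoint_inner_left _ _
    have e : ∀ J : L2 →L[ℂ] L2,
        (⟪(lam : ℂ) • (J.adjoint ∘L J) x, x⟫_ℂ).re = lam * ‖J x‖ ^ 2 := by
      intro J
      rw [inner_smul_left, ContinuousLinearMap.comp_apply,
        ContinuousLinearMap.adjoint_inner_left, Complex.conj_ofReal,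
        Complex.re_ofReal_mul]
      congr 1
      exact inner_self_eq_norm_sq (𝕜 := ℂ) _
    simp only [T, add_apply, smul_apply, inner_add_left, Complex.add_re, e, e']
    have h2 : ‖x‖ ≤ ‖J₀ x‖ + 2 * ‖J₁ x‖ + ‖J₂ x‖ := by
      have e2 : x = J₀ x + (2 : ℂ) • J₁ x + J₂ x := by
        simp only [J₀, J₁, J₂, ContinuousLinearMap.comp_apply]
        calc x = (S (S x) + S' (S x)) + (S (S' x) + S' (S' x)) := by rw [hadd, hadd, hadd]
          _ = _ := by rw [hcomm]; module
      calc ‖x‖ = ‖J₀ x + (2 : ℂ) • J₁ x + J₂ x‖ := congrArg _ e2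
        _ ≤ ‖J₀ x‖ + ‖(2 : ℂ) • J₁ x‖ + ‖J₂ x‖ := norm_add₃_le
        _ = _ := by rw [norm_smul]; simp
    -- Cauchy–Schwarz with weights `(1, 2, 1)`, and `6 = 1 + 4 + 1`.
    have h3 : ‖x‖ ^ 2 ≤ 6 * (‖J₀ x‖ ^ 2 + ‖J₁ x‖ ^ 2 + ‖J₂ x‖ ^ 2) := by
      have : ‖x‖ ^ 2 ≤ (‖J₀ x‖ + 2 * ‖J₁ x‖ + ‖J₂ x‖) ^ 2 := by gcongr
      nlinarith [sq_nonneg (2 * ‖J₀ x‖ - ‖J₁ x‖), sq_nonneg (‖J₀ x‖ - ‖J₂ x‖),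
        sq_nonneg (‖J₁ x‖ - 2 * ‖J₂ x‖)]
    have h4 := hW (J₀ x)
    have h5 := hW (J₁ x)
    have h6 : min c lam * ‖J₀ x‖ ^ 2 ≤ c * ‖J₀ x‖ ^ 2 := by gcongr; exact min_le_left _ _
    have h7 : min c lam * ‖J₁ x‖ ^ 2 ≤ c * ‖J₁ x‖ ^ 2 := by gcongr; exact min_le_left _ _
    have h8 : min c lam * ‖J₂ x‖ ^ 2 ≤ lam * ‖J₂ x‖ ^ 2 := by gcongr; exact min_le_right _ _
    have h9 : 0 ≤ lam * ‖J₁ x‖ ^ 2 := by positivity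
    have h10 := mul_le_mul_of_nonneg_left h3 hm.le
    linarith
  obtain ⟨Q, hQ⟩ := exists_rightInverse_of_coercive hm hT
  refine ⟨J₀ ∘L Q ∘L J₀.adjoint, J₀ ∘L Q ∘L J₂.adjoint, fun h k => ?_⟩
  have eQ : (J₀ ∘L Q ∘L J₀.adjoint) h + (J₀ ∘L Q ∘L J₂.adjoint) k =
      J₀ (Q (J₀.adjoint h + J₂.adjoint k)) := by simp
  rw [eQ]
  set x := Q (J₀.adjoint h + J₂.adjoint k) with hx
  refine ⟨J₁ x, J₂ x, ?_, hS _, fun v v' v'' hv hv' => ?_⟩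
  · simpa only [J₀, J₁, ContinuousLinearMap.comp_apply, hcomm] using hS (S x)
  -- The argument is `(1 + ∂)² v`, from which `J₀`, `J₁`, `J₂` recover `v`, `v'`, `v''`.
  have e : S ((v + v') + (v' + v'')) = v + v' := by
    rw [map_add, (hSS' _ _ hv).1, (hSS' _ _ hv').1]
  have e' : S' ((v + v') + (v' + v'')) = v' + v'' := by
    rw [map_add, (hSS' _ _ hv).2, (hSS' _ _ hv').2]
  have e0 : J₀ ((v + v') + (v' + v'')) = v := by
    rw [ContinuousLinearMap.comp_apply, e, (hSS' _ _ hv).1]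
  have e1 : J₁ ((v + v') + (v' + v'')) = v' := by
    rw [ContinuousLinearMap.comp_apply, e', (hSS' _ _ hv').1]
  have e2 : J₂ ((v + v') + (v' + v'')) = v'' := by
    rw [ContinuousLinearMap.comp_apply, e', (hSS' _ _ hv').2]
  have := congrArg (fun z => ⟪(v + v') + (v' + v''), z⟫_ℂ) (hQ (J₀.adjoint h + J₂.adjoint k))
  rw [← hx] at this
  simp only [T, add_apply, smul_apply, inner_add_right _ (_ + _),
    inner_add_right _ ((ContinuousLinearMap.adjoint _) _), inner_smul_right,
    ContinuousLinearMap.comp_apply W, ContinuousLinearMap.comp_apply (ContinuousLinearMap.adjoint _),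
    ContinuousLinearMap.adjoint_inner_right, e0, e1, e2] at this
  exact this

/-! ### Energy estimates and uniqueness -/

theorem mul_le_of_energy {c a b E : ℝ} (hc : 0 < c) (ha : 0 ≤ a) (hE : 0 ≤ E)
    (h : c * (a ^ 2 + b ^ 2) ≤ a * E) : c * a ≤ E ∧ c * b ≤ E := by
  have h1 : c * a ≤ E := by
    rcases ha.eq_or_lt with rfl | ha'
    · simpa using hE
    · have : a * (c * a) ≤ a * E := by nlinarith [sq_nonneg b]
      exact le_of_mul_le_mul_left this ha'
  refine ⟨h1, abs_le_of_sq_le_sq' ?_ ((mul_nonneg hc.le ha).trans h1) |>.2⟩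
  nlinarith [mul_nonneg hc.le ha, sq_nonneg a]

theorem IsWeakSol₂.energy {W : L2 →L[ℂ] L2} {c : ℝ} (hc : 0 < c)
    (hW : ∀ x, c * ‖x‖ ^ 2 ≤ (⟪W x, x⟫_ℂ).re) {u h : L2} (hu : IsWeakSol₂ W u h) :
    ∃ u' : L2, IsWeakDeriv u u' ∧ (∀ v v' : L2, IsWeakDeriv v v' →
      ⟪v, W u⟫_ℂ + ⟪v', W u'⟫_ℂ = ⟪v, h⟫_ℂ) ∧ c * ‖u‖ ≤ ‖h‖ ∧ c * ‖u'‖ ≤ ‖h‖ := by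
  obtain ⟨u', hu', H⟩ := hu
  refine ⟨u', hu', H, mul_le_of_energy hc (norm_nonneg _) (norm_nonneg _) ?_⟩
  have h1 := congrArg Complex.re (H u u' hu')
  have h2 := (Complex.re_le_norm _).trans (norm_inner_le_norm (𝕜 := ℂ) u h)
  have h3 := hW u
  have h4 := hW u'
  rw [Complex.add_re] at h1
  rw [← inner_conj_symm, Complex.conj_re] at h3 h4
  linarith

/-- Test with `u` itself; the `lam` terms are nonnegative and are dropped, so the bound is uniform
in `lam`. -/
theorem IsWeakSol₄.energy {W : L2 →L[ℂ] L2} {c : ℝ}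
    (hW : ∀ x, c * ‖x‖ ^ 2 ≤ (⟪W x, x⟫_ℂ).re) {lam : ℝ} (hlam : 0 ≤ lam) {u h : L2}
    {u' u'' : L2} (hu' : IsWeakDeriv u u') (hu'' : IsWeakDeriv u' u'')
    (H : ∀ v v' v'' : L2, IsWeakDeriv v v' → IsWeakDeriv v' v'' →
      ⟪v, W u⟫_ℂ + ⟪v', W u'⟫_ℂ + lam * ⟪v', u'⟫_ℂ + lam * ⟪v'', u''⟫_ℂ = ⟪v, h⟫_ℂ + ⟪v'', 0⟫_ℂ) :
    c * (‖u‖ ^ 2 + ‖u'‖ ^ 2) ≤ ‖u‖ * ‖h‖ := by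
  have h1 := congrArg Complex.re (H u u' u'' hu' hu'')
  have h2 := (Complex.re_le_norm _).trans (norm_inner_le_norm (𝕜 := ℂ) u h)
  have h3 := hW u
  have h4 := hW u'
  have e : ∀ x : L2, (⟪x, x⟫_ℂ).re = ‖x‖ ^ 2 := inner_self_eq_norm_sq (𝕜 := ℂ)
  simp only [Complex.add_re, Complex.re_ofReal_mul, e, inner_zero_right, add_zero] at h1
  rw [← inner_conj_symm, Complex.conj_re] at h3 h4
  have : 0 ≤ lam * ‖u'‖ ^ 2 := by positivity
  have : 0 ≤ lam * ‖u''‖ ^ 2 := by positivity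
  linarith

theorem IsWeakSol₂.unique {W : L2 →L[ℂ] L2} {c : ℝ} (hc : 0 < c)
    (hW : ∀ x, c * ‖x‖ ^ 2 ≤ (⟪W x, x⟫_ℂ).re) {u₁ u₂ h : L2} (h₁ : IsWeakSol₂ W u₁ h)
    (h₂ : IsWeakSol₂ W u₂ h) : u₁ = u₂ := by
  obtain ⟨a, ha, A⟩ := h₁
  obtain ⟨b, hb, B⟩ := h₂
  have : IsWeakSol₂ W (u₁ - u₂) 0 := by
    refine ⟨a - b, ha.sub hb, fun v v' hv => ?_⟩
    simp only [map_sub, inner_sub_right, inner_zero_right]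
    linear_combination A v v' hv - B v v' hv
  obtain ⟨_, -, -, h0, -⟩ := this.energy hc hW
  rw [norm_zero] at h0
  exact sub_eq_zero.1 (norm_le_zero_iff.1 (nonpos_of_mul_nonpos_right h0 hc))

theorem IsWeakSol₄.unique {W : L2 →L[ℂ] L2} {c : ℝ} (hc : 0 < c)
    (hW : ∀ x, c * ‖x‖ ^ 2 ≤ (⟪W x, x⟫_ℂ).re) {lam : ℝ} (hlam : 0 ≤ lam) {u₁ u₂ h k : L2}
    (h₁ : IsWeakSol₄ W lam u₁ h k) (h₂ : IsWeakSol₄ W lam u₂ h k) : u₁ = u₂ := by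
  obtain ⟨a, a', ha, ha', A⟩ := h₁
  obtain ⟨b, b', hb, hb', B⟩ := h₂
  have h0 := IsWeakSol₄.energy (h := 0) hW hlam (ha.sub hb) (ha'.sub hb') fun v v' v'' hv hv' => by
    simp only [map_sub, inner_sub_right, inner_zero_right]
    linear_combination A v v' v'' hv hv' - B v v' v'' hv hv'
  have := (mul_le_of_energy hc (norm_nonneg _) (norm_nonneg _) h0).1
  rw [norm_zero] at this
  exact sub_eq_zero.1 (norm_le_zero_iff.1 (nonpos_of_mul_nonpos_right this hc))

/-! ### Resolvents of graphs -/

/-- The closure of `T` is `{(R f, f - R f)}`: this set is closed and contains `T`, and its part over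
the dense set `s` lies in `T`. Injectivity of `R` is then exactly closability. -/
theorem isResolvent_of_dense {T : Set (L2 × L2)} {R : L2 →L[ℂ] L2} {s : Set L2} (hs : Dense s)
    (inj : ∀ h, R h = 0 → h = 0) (hT : ∀ p ∈ T, R (p.1 + p.2) = p.1)
    (hR : ∀ f ∈ s, (R f, f - R f) ∈ T) : IsResolvent T R := by
  have hcl : ∀ p ∈ closure T, R (p.1 + p.2) = p.1 := by
    have hc : IsClosed {p : L2 × L2 | R (p.1 + p.2) = p.1} :=
      isClosed_eq (by fun_prop) (by fun_prop)
    exact closure_minimal hT hc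
  refine ⟨fun h hh => inj h (by simpa using hcl _ hh), fun f u => ⟨?_, fun h => ?_⟩⟩
  · rintro rfl
    exact map_mem_closure (f := fun f => (R f, f - R f)) (by fun_prop) (hs f) hR
  · simpa using hcl _ h

theorem geomInner_eq {w : S1 → ℝ} (hw : MemLp w ∞ μ) (lam : ℝ) (f g : L2) :
    geomInner w lam f g = ⟪g, mulOp w hw f⟫_ℂ + lam * ⟪D g, D f⟫_ℂ := by
  rw [geomInner, inner_mulOp, L2.inner_def]
  rfl

theorem mem_laplacianGraph_zero_iff {w : S1 → ℝ} (hw : MemLp w ∞ μ) (u g : L2) :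
    (u, g) ∈ laplacianGraph w 0 ↔ IsWeakSol₂ (mulOp w hw) u (mulOp w hw (u + g)) := by
  simp only [laplacianGraph, adjointGraph, derivationDomain, geomSpace, if_true, Set.mem_univ,
    Set.mem_ofPred_eq, true_and, and_true, geomInner_eq hw, Complex.ofReal_zero, zero_mul, add_zero]
  have key : ∀ v v' u' : L2, ⟪u', mulOp w hw v'⟫_ℂ = ⟪g, mulOp w hw v⟫_ℂ ↔
      ⟪v, mulOp w hw u⟫_ℂ + ⟪v', mulOp w hw u'⟫_ℂ = ⟪v, mulOp w hw (u + g)⟫_ℂ := by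
    intro v v' u'
    rw [map_add, inner_add_right, add_right_inj, ← inner_mulOp_left, ← inner_mulOp_left,
      ← inner_conj_symm, ← inner_conj_symm _ v]
    exact (RingHom.injective (starRingEnd ℂ)).eq_iff
  constructor
  · rintro ⟨hu, H⟩
    refine ⟨D u, isWeakDeriv_D hu, fun v v' hv => ?_⟩
    have := H v ⟨v', hv⟩
    rw [D_eq hv] at this
    exact (key _ _ _).1 this
  · rintro ⟨u', hu', H⟩
    refine ⟨⟨u', hu'⟩, fun v hv => ?_⟩
    rw [D_eq hu']
    exact (key _ _ _).2 (H v _ (isWeakDeriv_D hv))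

/-- Moving the derivative off `g` in `lam ⟪v', g'⟫` leaves a right-hand side involving only `u + g ∈
L²`. The weak equation then no longer forces `g ∈ H¹`, which has to be recorded separately. -/
theorem mem_laplacianGraph_iff {w : S1 → ℝ} (hw : MemLp w ∞ μ) {lam : ℝ} (hlam : lam ≠ 0)
    (u g : L2) :
    (u, g) ∈ laplacianGraph w lam ↔
      g ∈ H1 ∧ IsWeakSol₄ (mulOp w hw) lam u (mulOp w hw (u + g)) (-(lam : ℂ) • (u + g)) := by
  simp only [laplacianGraph, adjointGraph, derivationDomain, geomSpace, if_neg hlam,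
    Set.mem_ofPred_eq, geomInner_eq hw]
  have key : ∀ v v' v'' u' u'' g' : L2, IsWeakDeriv v' v'' → IsWeakDeriv u u' →
      IsWeakDeriv g g' →
      (⟪u', mulOp w hw v'⟫_ℂ + lam * ⟪u'', v''⟫_ℂ = ⟪g, mulOp w hw v⟫_ℂ + lam * ⟪g', v'⟫_ℂ ↔
      ⟪v, mulOp w hw u⟫_ℂ + ⟪v', mulOp w hw u'⟫_ℂ + lam * ⟪v', u'⟫_ℂ + lam * ⟪v'', u''⟫_ℂ =
        ⟪v, mulOp w hw (u + g)⟫_ℂ + ⟪v'', -(lam : ℂ) • (u + g)⟫_ℂ) := by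
    intro v v' v'' u' u'' g' hv hu hg
    rw [← (RingHom.injective (starRingEnd ℂ)).eq_iff]
    simp only [map_add, map_mul, inner_conj_symm, Complex.conj_ofReal, inner_mulOp_left,
      inner_add_right, inner_smul_right, hv.inner_eq_neg hu, hv.inner_eq_neg hg]
    constructor <;> intro h <;> linear_combination h
  constructor
  · rintro ⟨⟨hu, -, hu'⟩, -, hg, H⟩
    refine ⟨hg, D u, D (D u), isWeakDeriv_D hu, isWeakDeriv_D hu', fun v v' v'' hv hv' => ?_⟩
    have e := D_eq hv
    have := H v ⟨⟨v', hv⟩, ⟨v', hv⟩, e ▸ ⟨v'', hv'⟩⟩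
    rw [e, D_eq hv'] at this
    exact (key _ _ _ _ _ _ hv' (isWeakDeriv_D hu) (isWeakDeriv_D hg)).1 this
  · rintro ⟨hg, u', u'', hu', hu'', H⟩
    have e := D_eq hu'
    refine ⟨⟨⟨u', hu'⟩, ⟨u', hu'⟩, e ▸ ⟨u'', hu''⟩⟩, e ▸ ⟨u'', hu''⟩, hg, ?_⟩
    rintro v ⟨hv, -, hv'⟩
    rw [e, D_eq hu'']
    exact (key _ _ _ _ _ _ (isWeakDeriv_D hv') hu' (isWeakDeriv_D hg)).2
      (H _ _ _ (isWeakDeriv_D hv) (isWeakDeriv_D hv'))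

theorem isResolvent_laplacianGraph_zero {w : S1 → ℝ} (hw : MemLp w ∞ μ) {c : ℝ} (hc : 0 < c)
    (h : ∀ᵐ θ ∂μ, c ≤ w θ) {R : L2 →L[ℂ] L2}
    (hR : ∀ f, IsWeakSol₂ (mulOp w hw) (R f) (mulOp w hw f)) :
    IsResolvent (laplacianGraph w 0) R := by
  have hW := le_re_inner_mulOp hw h
  refine isResolvent_of_dense dense_H1 (fun f hf => ?_) (fun p hp => ?_) fun f _ => ?_
  · obtain ⟨u', hu', H⟩ := hR f
    rw [hf] at hu' H
    have e0 : u' = 0 := isWeakDeriv_unique hu' (by simpa using hu'.smul 0)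
    have e1 : mulOp w hw f = 0 := by
      refine dense_H1.eq_zero_of_inner_right ℂ fun v hv => ?_
      obtain ⟨v', hv'⟩ := hv
      have := H v v' hv'
      rw [e0] at this
      simpa using this.symm
    exact mulOp_injective hw hc h (e1.trans (map_zero _).symm)
  · exact IsWeakSol₂.unique hc hW (hR _) ((mem_laplacianGraph_zero_iff hw p.1 p.2).1 hp)
  · rw [mem_laplacianGraph_zero_iff hw, add_sub_cancel]
    exact hR f

theorem isResolvent_laplacianGraph {w : S1 → ℝ} (hw : MemLp w ∞ μ) {c : ℝ} (hc : 0 < c)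
    (h : ∀ᵐ θ ∂μ, c ≤ w θ) {lam : ℝ} (hlam : 0 < lam) {R : L2 →L[ℂ] L2}
    (hR : ∀ f, IsWeakSol₄ (mulOp w hw) lam (R f) (mulOp w hw f) (-(lam : ℂ) • f)) :
    IsResolvent (laplacianGraph w lam) R := by
  have hW := le_re_inner_mulOp hw h
  refine isResolvent_of_dense dense_H1 (fun f hf => ?_) (fun p hp => ?_) fun f hf => ?_
  · obtain ⟨u', u'', hu', hu'', H⟩ := hR f
    rw [hf] at hu' H
    have e0 : u' = 0 := isWeakDeriv_unique hu' (by simpa using hu'.smul 0)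
    rw [e0] at hu''
    have e1 : u'' = 0 := isWeakDeriv_unique hu'' (by simpa using hu''.smul 0)
    have hlam' : (lam : ℂ) ≠ 0 := by exact_mod_cast hlam.ne'
    -- If `R f = 0`, the equation becomes `lam f'' = W f`. Pairing with `f` gives `⟪W f, f⟫ = -lam
    -- ‖f'‖² ≤ 0`, against coercivity unless `f = 0`.
    obtain ⟨b, hb, hb'⟩ := exists_isWeakDeriv_of_inner (a := f)
      (h := (lam : ℂ)⁻¹ • mulOp w hw f) fun v v' v'' hv hv' => by
        have := H v v' v'' hv hv'
        simp only [e0, e1, map_zero, inner_zero_right, mul_zero, add_zero, inner_smul_right]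
          at this
        rw [inner_smul_right, eq_inv_mul_iff_mul_eq₀ hlam']
        linear_combination this
    have h1 := congrArg Complex.re (hb'.inner_eq_neg hb)
    rw [inner_smul_left, map_inv₀, Complex.conj_ofReal, ← Complex.ofReal_inv,
      Complex.re_ofReal_mul, Complex.neg_re] at h1
    have h2 : (⟪b, b⟫_ℂ).re = ‖b‖ ^ 2 := inner_self_eq_norm_sq (𝕜 := ℂ) b
    have h3 : (⟪mulOp w hw f, f⟫_ℂ).re ≤ 0 := by
      refine nonpos_of_mul_nonpos_right (a := lam⁻¹) ?_ (inv_pos.2 hlam)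
      rw [h1, h2]
      exact neg_nonpos.2 (sq_nonneg _)
    have h4 := nonpos_of_mul_nonpos_right ((hW f).trans h3) hc
    exact norm_eq_zero.1 (pow_eq_zero_iff two_ne_zero |>.1 (le_antisymm h4 (sq_nonneg _)))
  · exact IsWeakSol₄.unique hc hW hlam.le (hR _)
      ((mem_laplacianGraph_iff hw hlam.ne' p.1 p.2).1 hp).2
  · rw [mem_laplacianGraph_iff hw hlam.ne', add_sub_cancel]
    refine ⟨?_, hR f⟩
    obtain ⟨f', hf'⟩ := hf
    obtain ⟨u', _, hu', -, -⟩ := hR f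
    exact ⟨_, hf'.sub hu'⟩

/-! ### The quantitative estimate -/

/-- Pair the equation with `φ''`. The fourth-order term contributes `-lam ‖φ'''‖²` and `lam φ''`
contributes `lam ‖φ''‖²`; both have the favourable sign, so `c ‖φ''‖²` is controlled by `e`, `W φ`
and `w' φ'` without any power of `lam`. -/
theorem IsWeakSol₄.exists_norm_deriv_le {w w' : S1 → ℝ} (hw : IsW1Infty w w') {c C : ℝ} (hc : 0 < c)
    (h : ∀ᵐ θ ∂μ, c ≤ w θ ∧ w θ ≤ C) {lam : ℝ} (hlam : 0 < lam) {φ e : L2}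
    (hφ : IsWeakSol₄ (mulOp w hw.memLp) lam φ e 0) :
    ∃ φ' φ'' : L2, IsWeakDeriv φ φ' ∧ IsWeakDeriv φ' φ'' ∧
      (∀ v v' v'' : L2, IsWeakDeriv v v' → IsWeakDeriv v' v'' →
        ⟪v, mulOp w hw.memLp φ⟫_ℂ + ⟪v', mulOp w hw.memLp φ'⟫_ℂ + lam * ⟪v', φ'⟫_ℂ +
          lam * ⟪v'', φ''⟫_ℂ = ⟪v, e⟫_ℂ) ∧
      c ^ 2 * ‖φ''‖ ≤ (c + C + (eLpNorm w' ∞ μ).toReal) * ‖e‖ := by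
  obtain ⟨φ', φ'', hφ', hφ'', H⟩ := hφ
  have hW := le_re_inner_mulOp hw.memLp (h.mono fun _ h => h.1)
  obtain ⟨b0, b1⟩ := mul_le_of_energy hc (norm_nonneg _) (norm_nonneg _)
    (IsWeakSol₄.energy hW hlam.le hφ' hφ'' H)
  refine ⟨φ', φ'', hφ', hφ'', fun v v' v'' hv hv' => by simpa using H v v' v'' hv hv', ?_⟩
  have hprod := hφ''.mulOp hw
  have n0 : ‖mulOp w hw.memLp φ‖ ≤ C * ‖φ‖ := norm_mulOp_le_of_ae hw.memLp
    (h.mono fun θ h => by rw [abs_of_nonneg (hc.le.trans h.1)]; exact h.2) φ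
  have n1 := norm_mulOp_le hw.memLp_deriv φ'
  have hC : 0 ≤ C := by
    obtain ⟨θ, h⟩ := h.exists
    exact hc.le.trans (h.1.trans h.2)
  have hM : 0 ≤ (eLpNorm w' ∞ μ).toReal := ENNReal.toReal_nonneg
  set M := (eLpNorm w' ∞ μ).toReal
  set W := mulOp w hw.memLp
  set W' := mulOp w' hw.memLp_deriv
  have hlam' : (lam : ℂ) ≠ 0 := by exact_mod_cast hlam.ne'
  -- Elliptic regularity: the weak equation exhibits `(φ'')''` as an `L²` function, so `φ'' ∈ H²`
  -- and pairing with `φ''` is legitimate; `b` is `φ'''`.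
  obtain ⟨b, hb, hb'⟩ := exists_isWeakDeriv_of_inner (a := φ'')
    (h := (lam : ℂ)⁻¹ • (e - W φ + (W' φ' + W φ'') + (lam : ℂ) • φ'')) fun v v' v'' hv hv' => by
      have := H v v' v'' hv hv'
      rw [hv.inner_eq_neg hprod, hv.inner_eq_neg hφ'', inner_zero_right] at this
      rw [inner_smul_right, eq_inv_mul_iff_mul_eq₀ hlam', inner_add_right, inner_add_right,
        inner_sub_right, inner_smul_right]
      linear_combination this
  have h1 := congrArg Complex.re (hb'.inner_eq_neg hb)
  rw [inner_smul_left, map_inv₀, Complex.conj_ofReal, ← Complex.ofReal_inv,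
    Complex.re_ofReal_mul, Complex.neg_re] at h1
  have h2 : (⟪b, b⟫_ℂ).re = ‖b‖ ^ 2 := inner_self_eq_norm_sq (𝕜 := ℂ) b
  have h3 : (⟪e - W φ + (W' φ' + W φ'') + (lam : ℂ) • φ'', φ''⟫_ℂ).re ≤ 0 := by
    refine nonpos_of_mul_nonpos_right (a := lam⁻¹) ?_ (inv_pos.2 hlam)
    rw [h1, h2]
    exact neg_nonpos.2 (sq_nonneg _)
  have h4 : (⟪φ'', φ''⟫_ℂ).re = ‖φ''‖ ^ 2 := inner_self_eq_norm_sq (𝕜 := ℂ) φ''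
  rw [inner_add_left, inner_add_left, inner_add_left, inner_sub_left, inner_smul_left,
    Complex.conj_ofReal] at h3
  simp only [Complex.add_re, Complex.sub_re, Complex.re_ofReal_mul, h4] at h3
  have k : ∀ x : L2, -(‖x‖ * ‖φ''‖) ≤ (⟪x, φ''⟫_ℂ).re ∧ (⟪x, φ''⟫_ℂ).re ≤ ‖x‖ * ‖φ''‖ :=
    fun x => abs_le.1 ((Complex.abs_re_le_norm _).trans (norm_inner_le_norm _ _))
  have h5 : c * ‖φ''‖ ^ 2 ≤ (‖e‖ + C * ‖φ‖ + M * ‖φ'‖) * ‖φ''‖ := by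
    have k0 : ‖W φ‖ * ‖φ''‖ ≤ C * ‖φ‖ * ‖φ''‖ := by gcongr
    have k1 : ‖W' φ'‖ * ‖φ''‖ ≤ M * ‖φ'‖ * ‖φ''‖ := by gcongr
    have := mul_nonneg hlam.le (sq_nonneg ‖φ''‖)
    linarith [(k e).1, (k (W φ)).2, (k (W' φ')).1, hW φ'']
  have h6 : c * ‖φ''‖ ≤ ‖e‖ + C * ‖φ‖ + M * ‖φ'‖ := by
    rcases (norm_nonneg φ'').eq_or_lt with h0 | h0
    · rw [← h0, mul_zero]
      positivity
    · refine le_of_mul_le_mul_right ?_ h0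
      linarith
  have h7 := mul_le_mul_of_nonneg_left h6 hc.le
  have h8 := mul_le_mul_of_nonneg_left b0 hC
  have h9 := mul_le_mul_of_nonneg_left b1 hM
  linarith

/-- The duality argument: both derivatives of the defect `lam ∂²(f - u₀ + u₀'')` fall on the dual
solution `φ`, so the defect is only needed in `L²`. -/
theorem norm_sub_le_of_isWeakSol {w w' : S1 → ℝ} (hw : IsW1Infty w w') {c C : ℝ} (hc : 0 < c)
    (h : ∀ᵐ θ ∂μ, c ≤ w θ ∧ w θ ≤ C) {lam : ℝ} (hlam : 0 < lam) {u u₀ f : L2}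
    (hu₀ : IsWeakSol₂ (mulOp w hw.memLp) u₀ (mulOp w hw.memLp f))
    (hu : IsWeakSol₄ (mulOp w hw.memLp) lam u (mulOp w hw.memLp f) (-(lam : ℂ) • f)) :
    c ^ 4 * ‖u - u₀‖ ≤ lam * ((c + C + (eLpNorm w' ∞ μ).toReal) *
      ((eLpNorm w' ∞ μ).toReal * C * ‖f‖)) := by
  have hc' : ∀ᵐ θ ∂μ, c ≤ w θ := h.mono fun _ h => h.1
  have hW := le_re_inner_mulOp hw.memLp hc'
  have nf : ‖mulOp w hw.memLp f‖ ≤ C * ‖f‖ := norm_mulOp_le_of_ae hw.memLp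
    (h.mono fun θ h => by rw [abs_of_nonneg (hc.le.trans h.1)]; exact h.2) f
  have hM : 0 ≤ (eLpNorm w' ∞ μ).toReal := ENNReal.toReal_nonneg
  have hC : 0 ≤ C := by
    obtain ⟨θ, h⟩ := h.exists
    exact hc.le.trans (h.1.trans h.2)
  obtain ⟨_, B, hB⟩ := exists_solutionOp₄ hc hW hlam
  obtain ⟨φ, hφ⟩ : ∃ φ, IsWeakSol₄ (mulOp w hw.memLp) lam φ (u - u₀) 0 := ⟨_, hB (u - u₀) 0⟩
  obtain ⟨φ', φ'', hφ', hφ'', Hφ, nφ⟩ := hφ.exists_norm_deriv_le hw hc h hlam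
  obtain ⟨v₁, hv₁, H₀, -, n₁⟩ := hu₀.energy hc hW
  obtain ⟨u₁, u₂, hu₁, hu₂, H⟩ := hu
  have n' := norm_mulOp_le hw.memLp_deriv v₁
  have hWv : IsWeakDeriv (mulOp w hw.memLp v₁) (mulOp w hw.memLp (u₀ - f)) := by
    refine isWeakDeriv_of_inner fun v v' hv => ?_
    rw [map_sub, inner_sub_right]
    linear_combination H₀ v v' hv
  -- `u₀ ∈ H²`, so `u - u₀` is an admissible test function in the equation for `φ`.
  obtain ⟨v₂, hv₂⟩ := exists_isWeakDeriv_of_mulOp hw hc hc' hWv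
  have hq := isWeakDeriv_unique hWv (hv₂.mulOp hw)
  set M := (eLpNorm w' ∞ μ).toReal
  set W := mulOp w hw.memLp
  set W' := mulOp w' hw.memLp_deriv
  have hWq : W (f - u₀ + v₂) = -W' v₁ := by
    rw [map_sub] at hq
    rw [map_add, map_sub, eq_neg_iff_add_eq_zero]
    have : W' v₁ = W u₀ - W f - W v₂ := by rw [hq]; abel
    rw [this]
    abel
  have nq : c ^ 2 * ‖f - u₀ + v₂‖ ≤ M * C * ‖f‖ := by
    have k1 : c * ‖f - u₀ + v₂‖ ^ 2 ≤ ‖W' v₁‖ * ‖f - u₀ + v₂‖ := by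
      refine (hW _).trans ((Complex.re_le_norm _).trans ((norm_inner_le_norm _ _).trans_eq ?_))
      rw [hWq, norm_neg]
    have k2 : c * ‖f - u₀ + v₂‖ ≤ ‖W' v₁‖ := by
      rcases (norm_nonneg (f - u₀ + v₂)).eq_or_lt with h0 | h0
      · rw [← h0, mul_zero]
        positivity
      · exact le_of_mul_le_mul_right (by linarith) h0
    have k3 := mul_le_mul_of_nonneg_left (k2.trans n') hc.le
    have k4 := mul_le_mul_of_nonneg_left (n₁.trans nf) hM
    linarith
  have hd := Hφ _ _ _ (hu₁.sub hv₁) (hu₂.sub hv₂)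
  have hself : ∀ x y, conj ⟪x, W y⟫_ℂ = ⟪y, W x⟫_ℂ := fun x y => by
    rw [inner_conj_symm, inner_mulOp_left]
  have key : ⟪u - u₀, u - u₀⟫_ℂ = conj (-(lam : ℂ) * ⟪φ'', f - u₀ + v₂⟫_ℂ) := by
    rw [← hd]
    apply (RingHom.injective (starRingEnd ℂ))
    have g1 := H φ φ' φ'' hφ' hφ''
    have g0 := H₀ φ φ' hφ'
    have g2 := hφ''.inner_eq_neg hv₁
    simp only [map_add, map_mul, hself, inner_conj_symm, Complex.conj_ofReal,
      map_sub, inner_sub_right, inner_add_right, inner_smul_right, map_neg] at g1 g0 g2 ⊢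
    linear_combination g1 - g0 - (lam : ℂ) * g2
  have n : ‖u - u₀‖ ^ 2 ≤ lam * (‖φ''‖ * ‖f - u₀ + v₂‖) := by
    have : ‖u - u₀‖ ^ 2 = ‖⟪u - u₀, u - u₀⟫_ℂ‖ := by
      rw [inner_self_eq_norm_sq_to_K]; simp
    rw [this, key, RCLike.norm_conj, norm_mul, norm_neg, Complex.norm_real,
      Real.norm_of_nonneg hlam.le]
    gcongr
    exact norm_inner_le_norm _ _
  rcases (norm_nonneg (u - u₀)).eq_or_lt with h0 | h0
  · rw [← h0, mul_zero]
    positivity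
  · refine le_of_mul_le_mul_right ?_ h0
    calc c ^ 4 * ‖u - u₀‖ * ‖u - u₀‖ = c ^ 4 * ‖u - u₀‖ ^ 2 := by ring
      _ ≤ c ^ 4 * (lam * (‖φ''‖ * ‖f - u₀ + v₂‖)) := by gcongr
      _ = lam * ((c ^ 2 * ‖φ''‖) * (c ^ 2 * ‖f - u₀ + v₂‖)) := by ring
      _ ≤ lam * (((c + C + M) * ‖u - u₀‖) * (M * C * ‖f‖)) := by gcongr
      _ = _ := by ring

end CircleGeometry

theorem theorem7 :
    ∃ C : ℝ → ℝ → ℝ → ℝ,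
      ∀ (wm wp : ℝ) (w w' : CircleGeometry.S1 → ℝ),
        0 < wm →
        CircleGeometry.IsW1Infty w w' →
        (∀ᵐ θ ∂CircleGeometry.μ, wm ≤ w θ ∧ w θ ≤ wp) →
        ∃ R₀ : CircleGeometry.L2 →L[ℂ] CircleGeometry.L2,
          CircleGeometry.IsResolvent (CircleGeometry.laplacianGraph w 0) R₀ ∧
          ∀ lam : ℝ, 0 < lam →
            ∃ R : CircleGeometry.L2 →L[ℂ] CircleGeometry.L2,
              CircleGeometry.IsResolvent (CircleGeometry.laplacianGraph w lam) R ∧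
              ‖R - R₀‖ ≤ C wm wp (eLpNorm w' ∞ CircleGeometry.μ).toReal * lam := by
  -- Product of `(wm + wp + M) / wm²`, from the bound on `φ''`, and `M wp / wm²`, from the bound on
  -- `f - u₀ + u₀''`. It vanishes for `M = 0`, in accordance with the resolvents agreeing for
  -- constant weights.
  refine ⟨fun wm wp M => (wm + wp + M) * (M * wp) / wm ^ 4, fun wm wp w w' hwm hw h => ?_⟩
  have hwm' : ∀ᵐ θ ∂CircleGeometry.μ, wm ≤ w θ := h.mono fun _ h => h.1
  have hW := CircleGeometry.le_re_inner_mulOp hw.memLp hwm'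
  have hwp : 0 ≤ wp := by
    obtain ⟨θ, h⟩ := h.exists
    exact hwm.le.trans (h.1.trans h.2)
  obtain ⟨A₀, hA₀⟩ := CircleGeometry.exists_solutionOp₂ hwm hW
  have hR₀ := fun f => hA₀ (CircleGeometry.mulOp w hw.memLp f)
  refine ⟨A₀ ∘L CircleGeometry.mulOp w hw.memLp,
    CircleGeometry.isResolvent_laplacianGraph_zero hw.memLp hwm hwm' hR₀, fun lam hlam => ?_⟩
  obtain ⟨A, B, hAB⟩ := CircleGeometry.exists_solutionOp₄ hwm hW hlam
  have hR : ∀ f, CircleGeometry.IsWeakSol₄ (CircleGeometry.mulOp w hw.memLp) lam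
      ((A ∘L CircleGeometry.mulOp w hw.memLp + (-(lam : ℂ)) • B) f)
      (CircleGeometry.mulOp w hw.memLp f) (-(lam : ℂ) • f) := fun f => by
    have := hAB (CircleGeometry.mulOp w hw.memLp f) (-(lam : ℂ) • f)
    rwa [map_smul] at this
  refine ⟨_, CircleGeometry.isResolvent_laplacianGraph hw.memLp hwm hwm' hlam hR, ?_⟩
  refine ContinuousLinearMap.opNorm_le_bound _ (by positivity) fun f => ?_
  have := CircleGeometry.norm_sub_le_of_isWeakSol hw hwm h hlam (hR₀ f) (hR f)
  rw [div_mul_eq_mul_div, div_mul_eq_mul_div, le_div_iff₀ (by positivity)]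
  refine le_trans (le_of_eq ?_) (this.trans (le_of_eq ?_))
  · rw [mul_comm, sub_apply]
    rfl
  · ring
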